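/- Let $p$ be an odd prime, $m\ge 1$ an integer, $q=p^m$, and let $\mathrm{Tr}$ denote the trace from $\mathrm{GF}(q)$ to $\mathrm{GF}(p)$. Let $$\mathcal C=\left\{\left((\mathrm{Tr}(ax^2+bx)+c)_{x\in \mathrm{GF}(q)},\ \mathrm{Tr}(a),\ \mathrm{Tr}(b)\right): a,b\in \mathrm{GF}(q),\ c\in \mathrm{GF}(p)\right\},$$ a linear code of length $q+2$ over $\mathrm{GF}(p)$. An $[n,k,d]$ code is a linear code of length $n$, dimension $k$ and minimum Hamming distance $d$; it is almost MDS if $n-k+1-d=1$. In the tables below, the number of codewords of a given Hamming weight is the sum of the multiplicities of all rows with that weight (some rows have equal weights for some $p,m$), and it is $0$ for weights that do not occur in the table. Then the following hold. (1) If $m=1$, then $\mathcal C$ is an almost MDS $[p+2,3,p-1]$ code. If $m>1$ is odd, then $\mathcal C$ is a $[p^m+2,\,2m+1,\,p^{m-1}(p-1)-p^{\frac{m-1}{2}}]$ code. For every odd $m\geq 1$, writing $N=p^{m-1}(p-1)$ and $D=p^{\frac{m-1}{2}}(-1)^{\frac{(p-1)(m+1)}{4}}$, the weight distribution of $\mathcal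 C$ is $$\begin{array}{ll} \text{Weight} & \text{Multiplicity}\\ \hline 0 & 1\\ p^m & p-1\\ N & (p^{m-1}-1)(p+p^{m-1})\\ N+1 & (p^m-p^{m-1})(p+2p^{m-1}-1)\\ N+2 & (p^m-p^{m-1})^2\\ N-D & \frac12 p^{m-1}(p-1)(p^{m-1}-1)\\ N-D+1 & \frac12 p^{m-1}(p-1)^2(2p^{m-1}-1)\\ N-D+2 & \frac12 p^{2m-2}(p-1)^3\\ N+D & \frac12 p^{m-1}(p-1)(p^{m-1}-1)\\ N+D+1 & \frac12 p^{m-1}(p-1)^2(2p^{m-1}-1)\\ N+D+2 & \frac12 p^{2m-2}(p-1)^3 \end{array}$$ (2) If $m\ge 2$ is even, then $\mathcal C$ is a $[p^m+2,\,2m+1,\,p^{m-1}(p-1)-(p-1)p^{\frac{m-2}{2}}]$ code and, writing $N=p^{m-1}(p-1)$ and $E=p^{\frac{m-2}{2}}(-1)^{\frac{m(p-1)}{4}}$, its weight distribution is $$\begin{array}{ll} \text{Weight} & \text{Multiplicity}\\ \hline 0 & 1\\ p^m & p-1\\ N & p(p^{m-1}-1)\\ N+1 & p^m(p-1)\\ N+(p-1)E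 & \frac12 p^{m-1}(p^{m-1}-1-(p-1)E)\\ N+(p-1)E+1 & \frac12 p^{m-1}(p-1)(2p^{m-1}-1-(p-2)E)\\ N+(p-1)E+2 & \frac12 p^{m-1}(p-1)^2(p^{m-1}+E)\\ N-(p-1)E & \frac12 p^{m-1}(p^{m-1}-1+(p-1)E)\\ N-(p-1)E+1 & \frac12 p^{m-1}(p-1)(2p^{m-1}-1+(p-2)E)\\ N-(p-1)E+2 & \frac12 p^{m-1}(p-1)^2(p^{m-1}-E)\\ N-E & \frac12 p^{m-1}(p-1)(p^{m-1}-1-(p-1)E)\\ N-E+1 & \frac12 p^{m-1}(p-1)^2(2p^{m-1}-1-(p-2)E)\\ N-E+2 & \frac12 p^{m-1}(p-1)^3(p^{m-1}+E)\\ N+E & \frac12 p^{m-1}(p-1)(p^{m-1}-1+(p-1)E)\\ N+E+1 & \frac12 p^{m-1}(p-1)^2(2p^{m-1}-1+(p-2)E)\\ N+E+2 & \frac12 p^{m-1}(p-1)^3(p^{m-1}-E) \end{array}$$ -/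

import Mathlib

noncomputable section

namespace PAryCode

/-- The minimum (Hamming) distance of the linear code `C` exists and equals `d`:
`d` is the least distance between two distinct codewords. -/
def HasMinDist {K ι : Type*} [Field K] [DecidableEq K] [Fintype ι]
    (C : Submodule K (ι → K)) (d : ℕ) : Prop :=
  IsLeast {r : ℕ | ∃ u ∈ C, ∃ v ∈ C, u ≠ v ∧ hammingDist u v = r} d

/-- `C` is an `[n, k, d]` linear code over `K`: length `n`, dimension `k`, minimum distance `d`. -/
def IsLinearCode {K ι : Type*} [Field K] [DecidableEq K] [Fintype ι]
    (C : Submodule K (ι → K)) (n k d : ℕ) : Prop :=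
  Fintype.card ι = n ∧ Module.finrank K C = k ∧ HasMinDist C d

/-- `C` is almost MDS: its Singleton defect `n - k + 1 - d` is equal to `1`, i.e. `d = n - k`. -/
def IsAlmostMDS {K ι : Type*} [Field K] [DecidableEq K] [Fintype ι]
    (C : Submodule K (ι → K)) : Prop :=
  ∃ n k d : ℕ, IsLinearCode C n k d ∧ (n : ℤ) - k + 1 - d = 1

/-- A table of pairs (weight, multiplicity) is the weight distribution of `C`: for every `w`, the
number of codewords of weight `w` is the sum of the multiplicities of the rows with weight `w`
(none: `0`).  For some parameters different rows of a table have the same weight. -/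
def HasWeightDistribution {K ι : Type*} [Field K] [DecidableEq K] [Fintype ι]
    (C : Submodule K (ι → K)) (T : List (ℤ × ℚ)) : Prop :=
  ∀ w : ℤ, (({c : ι → K | c ∈ C ∧ (hammingNorm c : ℤ) = w}.ncard : ℕ) : ℚ) =
    ((T.filter (fun r => r.1 = w)).map Prod.snd).sum

/-- The word `((Tr(a x² + b x) + c)_{x ∈ F}, Tr(a), Tr(b))`, with `Tr` the trace from `F` to
`GF(p)`; the coordinates are indexed by `F` together with two further positions. -/
def codeword (p : ℕ) [Fact p.Prime] (F : Type*) [Field F] [Algebra (ZMod p) F]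
    (a b : F) (c : ZMod p) : F ⊕ Fin 2 → ZMod p :=
  Sum.elim (fun x => Algebra.trace (ZMod p) F (a * x ^ 2 + b * x) + c)
    ![Algebra.trace (ZMod p) F a, Algebra.trace (ZMod p) F b]

/-- The `p`-ary linear code of all words `codeword p F a b c`, `a, b ∈ F`, `c ∈ GF(p)`. -/
def code (p : ℕ) [Fact p.Prime] (F : Type*) [Field F] [Algebra (ZMod p) F] :
    Submodule (ZMod p) (F ⊕ Fin 2 → ZMod p) where
  carrier := {w | ∃ (a b : F) (c : ZMod p), w = codeword p F a b c}
  zero_mem' := by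
    refine ⟨0, 0, 0, ?_⟩
    funext i
    rcases i with x | i
    · simp [codeword]
    · fin_cases i <;> simp [codeword]
  add_mem' := by
    rintro _ _ ⟨a, b, c, rfl⟩ ⟨a', b', c', rfl⟩
    refine ⟨a + a', b + b', c + c', ?_⟩
    funext i
    rcases i with x | i
    · simp only [codeword, Pi.add_apply, Sum.elim_inl, add_mul, map_add]
      ring
    · fin_cases i <;> simp [codeword]
  smul_mem' := by
    rintro t _ ⟨a, b, c, rfl⟩
    refine ⟨t • a, t • b, t * c, ?_⟩
    funext i
    rcases i with x | i
    · simp only [codeword, Pi.smul_apply, Sum.elim_inl, smul_mul_assoc, map_add, map_smul,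
        smul_eq_mul]
      ring
    · fin_cases i <;> simp [codeword]

/-- The table of (weight, multiplicity) for odd `m`.  The exponents `(m - 1) / 2` and
`(p - 1) * (m + 1) / 4` are integers when `p` and `m` are odd. -/
def tableOdd (p m : ℕ) : List (ℤ × ℚ) :=
  -- the weight `p^(m-1) (p-1)`
  let N : ℤ := (p : ℤ) ^ (m - 1) * ((p : ℤ) - 1)
  -- the signed deviation `p^((m-1)/2) (-1)^((p-1)(m+1)/4)`
  let D : ℤ := (p : ℤ) ^ ((m - 1) / 2) * (-1) ^ ((p - 1) * (m + 1) / 4)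
  let P : ℚ := p
  let Q : ℚ := (p : ℚ) ^ (m - 1)
  [ (0, 1),
    ((p : ℤ) ^ m, P - 1),
    (N, (Q - 1) * (P + Q)),
    (N + 1, (P ^ m - Q) * (P + 2 * Q - 1)),
    (N + 2, (P ^ m - Q) ^ 2),
    (N - D, Q * (P - 1) * (Q - 1) / 2),
    (N - D + 1, Q * (P - 1) ^ 2 * (2 * Q - 1) / 2),
    (N - D + 2, P ^ (2 * m - 2) * (P - 1) ^ 3 / 2),
    (N + D, Q * (P - 1) * (Q - 1) / 2),
    (N + D + 1, Q * (P - 1) ^ 2 * (2 * Q - 1) / 2),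
    (N + D + 2, P ^ (2 * m - 2) * (P - 1) ^ 3 / 2) ]

/-- The table of (weight, multiplicity) for even `m`.  The exponents `(m - 2) / 2` and
`m * (p - 1) / 4` are integers when `p` is odd and `m` is even, and then
`√-1 ^ ((p - 1) * m / 2) = (-1) ^ (m * (p - 1) / 4)`. -/
def tableEven (p m : ℕ) : List (ℤ × ℚ) :=
  -- the weight `p^(m-1) (p-1)`
  let N : ℤ := (p : ℤ) ^ (m - 1) * ((p : ℤ) - 1)
  -- `p^((m-2)/2) (-1)^(m(p-1)/4)`, as an integer and as a rational number
  let E : ℤ := (p : ℤ) ^ ((m - 2) / 2) * (-1) ^ (m * (p - 1) / 4)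
  let R : ℚ := (p : ℚ) ^ ((m - 2) / 2) * (-1) ^ (m * (p - 1) / 4)
  let P : ℚ := p
  let Q : ℚ := (p : ℚ) ^ (m - 1)
  [ (0, 1),
    ((p : ℤ) ^ m, P - 1),
    (N, P * (Q - 1)),
    (N + 1, P ^ m * (P - 1)),
    (N + ((p : ℤ) - 1) * E, Q * (Q - 1 - (P - 1) * R) / 2),
    (N + ((p : ℤ) - 1) * E + 1, Q * (P - 1) * (2 * Q - 1 - (P - 2) * R) / 2),
    (N + ((p : ℤ) - 1) * E + 2, Q * (P - 1) ^ 2 * (Q + R) / 2),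
    (N - ((p : ℤ) - 1) * E, Q * (Q - 1 + (P - 1) * R) / 2),
    (N - ((p : ℤ) - 1) * E + 1, Q * (P - 1) * (2 * Q - 1 + (P - 2) * R) / 2),
    (N - ((p : ℤ) - 1) * E + 2, Q * (P - 1) ^ 2 * (Q - R) / 2),
    (N - E, Q * (P - 1) * (Q - 1 - (P - 1) * R) / 2),
    (N - E + 1, Q * (P - 1) ^ 2 * (2 * Q - 1 - (P - 2) * R) / 2),
    (N - E + 2, Q * (P - 1) ^ 3 * (Q + R) / 2),
    (N + E, Q * (P - 1) * (Q - 1 + (P - 1) * R) / 2),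
    (N + E + 1, Q * (P - 1) ^ 2 * (2 * Q - 1 + (P - 2) * R) / 2),
    (N + E + 2, Q * (P - 1) ^ 3 * (Q - R) / 2) ]

end PAryCode

end

/-! Let η be the quadratic character of F, extended by η(0) = 0, N = p^(m-1)(p-1), and S(t) the sum
of η(y) over the y with Tr(y) = t (`traceCharSum`). For a ≠ 0, completing the square turns Tr(ax² +
bx) + c = 0 into Tr(ax²) = t with t = Tr(b²/(4a)) - c. This has p^(m-1) + η(a)S(t) solutions,
because y has 1 + η(y) square roots. The weight is therefore N - η(a)S(t), plus 1 for each of Tr(a),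
Tr(b) that is nonzero (`hammingNorm_codeword_quadratic`).

No Gauss sums are needed to find S: it satisfies S(st) = η(s)S(t) for s in GF(p)*, ΣS(t) = 0 and
ΣS(t)² = N. For odd m, η is nontrivial on GF(p)*, so S(0) = 0 and S(t)² is constant for t ≠ 0, hence
equal to p^(m-1). For even m, η is trivial on GF(p)*, so S is constant off 0; S(0) comes from the
subfield K of index 2, since η is constant on the nonzero elements of relative trace zero
(`traceCharSum_zero_of_tower`), and ΣS(t) = 0 then gives the other value.

For fixed a ≠ 0 and b, t runs once over GF(p) as c does. Hence b matters only through whether Tr(b)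
vanishes, and a only through η(a) and whether Tr(a) vanishes, a joint distribution again governed by
S(0). Sums of an arbitrary function φ of the weight (`sum_comp_hammingNorm`) then yield the tables.
The minimum distance follows from the maximum of |S| and the existence of a suitable a of trace
zero; for m = 1 there is none, which costs one extra unit of weight. -/

noncomputable section

namespace PAryCode

open Finset

/-- Every fibre of a surjective homomorphism of finite groups has `|G| / |H|` elements. -/
lemma card_fiber_mul_card {G H : Type*} [AddGroup G] [AddGroup H] [Fintype G] [Fintype H]
    [DecidableEq H] (f : G →+ H) (hf : Function.Surjective f) (t : H) :
    #{x | f x = t} * Fintype.card H = Fintype.card G := by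
  have h1 : ∀ s : H, #{x | f x = s} = #{x | f x = t} := fun s =>
    AddMonoidHom.card_fiber_eq_of_mem_range f (hf s) (hf t)
  have h2 := Finset.card_eq_sum_card_fiberwise (f := f) (s := univ) (t := univ) (by simp)
  rw [Finset.sum_congr rfl (fun s _ => h1 s)] at h2
  simpa [mul_comm] using h2.symm

/-! ### Quadratic character sums over the fibres of the trace. -/

section CharSum

variable (p : ℕ) [Fact p.Prime] (F : Type*) [Field F] [Fintype F] [DecidableEq F]
  [Algebra (ZMod p) F]

/-- The sum of the quadratic character over the elements of trace `t`. -/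
def traceCharSum (t : ZMod p) : ℤ :=
  ∑ y : F, if Algebra.trace (ZMod p) F y = t then quadraticChar F y else 0

variable {F}

omit [Fintype F] [DecidableEq F] in
lemma ringChar_ne_two (hp : Odd p) : ringChar F ≠ 2 := by
  have : CharP F p := charP_of_injective_algebraMap (algebraMap (ZMod p) F).injective p
  rw [ringChar.eq F p]
  rintro rfl
  exact absurd hp (by decide)

variable {p} {m : ℕ}

omit [DecidableEq F] in
lemma sum_trace_eq (hm : 0 < m) (hF : Fintype.card F = p ^ m) (t : ZMod p) :
    ∑ y : F, (if Algebra.trace (ZMod p) F y = t then (1 : ℤ) else 0) = (p : ℤ) ^ (m - 1) := by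
  have h := card_fiber_mul_card (Algebra.trace (ZMod p) F).toAddMonoidHom
    (Algebra.trace_surjective (ZMod p) F) t
  rw [ZMod.card, hF, ← Nat.sub_add_cancel hm, pow_succ] at h
  have h' := Nat.eq_of_mul_eq_mul_right (Fact.out : p.Prime).pos h
  rw [Finset.sum_boole]
  exact_mod_cast h'

omit [DecidableEq F] in
lemma sum_trace_mul_eq (hm : 0 < m) (hF : Fintype.card F = p ^ m) {a : F} (ha : a ≠ 0)
    (t : ZMod p) :
    ∑ y : F, (if Algebra.trace (ZMod p) F (a * y) = t then (1 : ℤ) else 0)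
      = (p : ℤ) ^ (m - 1) := by
  rw [← sum_trace_eq hm hF t]
  exact Equiv.sum_comp (Equiv.mulLeft₀ a ha)
    (fun y => if Algebra.trace (ZMod p) F y = t then (1 : ℤ) else 0)

-- In odd characteristic each y has exactly 1 + η(y) square roots.
omit [Algebra (ZMod p) F] [Fact p.Prime] in
lemma sum_comp_sq (h2 : ringChar F ≠ 2) (g : F → ℤ) :
    ∑ x : F, g (x ^ 2) = ∑ y : F, (quadraticChar F y + 1) * g y := by
  have h1 : ∀ y : F, (quadraticChar F y + 1) * g y = ∑ x : F, if x ^ 2 = y then g y else 0 := by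
    intro y
    rw [← quadraticChar_card_sqrts h2 y, ← Finset.sum_filter, Finset.sum_const, nsmul_eq_mul]
    congr 2
    exact_mod_cast congrArg Finset.card (by ext; simp)
  rw [Finset.sum_congr rfl (fun y _ => h1 y), Finset.sum_comm]
  exact Finset.sum_congr rfl (fun x _ => by simp)

omit [Algebra (ZMod p) F] [Fact p.Prime] in
lemma quadraticChar_mul_self {a : F} (ha : a ≠ 0) : quadraticChar F a * quadraticChar F a = 1 := by
  rw [← sq]; exact quadraticChar_sq_one ha

lemma sum_trace_mul_char {a : F} (ha : a ≠ 0) (t : ZMod p) :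
    ∑ y : F, (if Algebra.trace (ZMod p) F (a * y) = t then quadraticChar F y else 0)
      = quadraticChar F a * traceCharSum p F t := by
  have h := Equiv.sum_comp (Equiv.mulLeft₀ a ha)
    (fun y => if Algebra.trace (ZMod p) F y = t then quadraticChar F y else 0)
  rw [traceCharSum, ← h, Finset.mul_sum]
  refine Finset.sum_congr rfl fun y _ => ?_
  simp only [Equiv.mulLeft₀_apply, map_mul, mul_ite, mul_zero, ← mul_assoc,
    quadraticChar_mul_self ha, one_mul]

/-- The number of solutions of `Tr(a x²) = t`. -/
lemma sum_trace_mul_sq (hp : Odd p) (hm : 0 < m) (hF : Fintype.card F = p ^ m) {a : F}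
    (ha : a ≠ 0) (t : ZMod p) :
    ∑ x : F, (if Algebra.trace (ZMod p) F (a * x ^ 2) = t then (1 : ℤ) else 0)
      = (p : ℤ) ^ (m - 1) + quadraticChar F a * traceCharSum p F t := by
  rw [sum_comp_sq (ringChar_ne_two p hp)
    (fun y => if Algebra.trace (ZMod p) F (a * y) = t then (1 : ℤ) else 0),
    ← sum_trace_mul_char ha, ← sum_trace_mul_eq hm hF ha t, ← Finset.sum_add_distrib]
  exact Finset.sum_congr rfl fun y _ => by split_ifs <;> ring

lemma sum_traceCharSum (hp : Odd p) : ∑ t : ZMod p, traceCharSum p F t = 0 := by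
  simp only [traceCharSum]
  rw [Finset.sum_comm]
  simp only [Finset.sum_ite_eq, mem_univ, if_true]
  exact quadraticChar_sum_zero (ringChar_ne_two p hp)

/-- Multiplication by s permutes F, carries trace t to trace st by linearity, and multiplies η by
η(s) = ±1. -/
lemma traceCharSum_mul {s : ZMod p} (hs : s ≠ 0) (t : ZMod p) :
    traceCharSum p F (s * t) = quadraticChar F (algebraMap (ZMod p) F s) * traceCharSum p F t := by
  have hs' : algebraMap (ZMod p) F s ≠ 0 := by simpa using hs
  have h := sum_trace_mul_char (F := F) hs' (s * t)
  have h' : traceCharSum p F t = quadraticChar F (algebraMap (ZMod p) F s) *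
      traceCharSum p F (s * t) := by
    rw [← h, traceCharSum]
    refine Finset.sum_congr rfl fun y _ => ?_
    rw [← Algebra.smul_def, map_smul, smul_eq_mul]
    simp [hs]
  rw [h', ← mul_assoc, quadraticChar_mul_self hs', one_mul]

/-- The second moment of `traceCharSum`. -/
lemma sum_traceCharSum_sq (hp : Odd p) (hm : 0 < m) (hF : Fintype.card F = p ^ m) :
    ∑ t : ZMod p, traceCharSum p F t ^ 2 = (p : ℤ) ^ (m - 1) * (p - 1) := by
  have hq : (p : ℤ) ^ m = p * (p : ℤ) ^ (m - 1) := by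
    rw [← pow_succ', Nat.sub_add_cancel hm]
  have h1 : ∑ t : ZMod p, traceCharSum p F t ^ 2 = ∑ z : F, quadraticChar F z *
      traceCharSum p F (Algebra.trace (ZMod p) F z) := by
    have : ∀ t : ZMod p, traceCharSum p F t ^ 2 = ∑ z : F,
        if Algebra.trace (ZMod p) F z = t then quadraticChar F z * traceCharSum p F t else 0 := by
      intro t
      rw [sq]
      conv_lhs => lhs; rw [traceCharSum]
      rw [Finset.sum_mul]
      exact Finset.sum_congr rfl fun y _ => by split_ifs <;> simp
    rw [Finset.sum_congr rfl fun t _ => this t, Finset.sum_comm]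
    simp
  -- The substitution y = zu in S(Tr z) produces a second factor η(z), which cancels the first. The
  -- case z = 0 is set apart because η(0) = 0.
  have h2 : ∀ z : F, quadraticChar F z * traceCharSum p F (Algebra.trace (ZMod p) F z) =
      ∑ u : F, quadraticChar F u * (if z = 0 then 0 else
        if Algebra.trace (ZMod p) F ((u - 1) * z) = 0 then 1 else 0) := by
    intro z
    by_cases hz : z = 0
    · simp [hz]
    · rw [← sum_trace_mul_char hz]
      refine Finset.sum_congr rfl fun u _ => ?_
      simp [hz, sub_mul, sub_eq_zero, mul_comm z u]
  have h3 : ∀ u : F, ∑ z : F, (if z = 0 then (0 : ℤ) else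
        if Algebra.trace (ZMod p) F ((u - 1) * z) = 0 then 1 else 0) =
      ((p : ℤ) ^ (m - 1) - 1) + if u = 1 then (p : ℤ) ^ m - (p : ℤ) ^ (m - 1) else 0 := by
    intro u
    have : ∀ z : F, (if z = 0 then (0 : ℤ) else
        if Algebra.trace (ZMod p) F ((u - 1) * z) = 0 then 1 else 0) =
        (if Algebra.trace (ZMod p) F ((u - 1) * z) = 0 then 1 else 0) -
        if z = 0 then 1 else 0 := by
      intro z
      by_cases hz : z = 0 <;> simp [hz]
    rw [Finset.sum_congr rfl fun z _ => this z, Finset.sum_sub_distrib]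
    by_cases hu : u = 1
    · simp [hu, hF]
    · rw [sum_trace_mul_eq hm hF (sub_ne_zero.mpr hu)]
      simp [hu]
  -- The part of `h3` independent of u is killed by Ση(u) = 0; only u = 1 survives, contributing p^m
  -- - p^(m-1).
  rw [h1, Finset.sum_congr rfl fun z _ => h2 z, Finset.sum_comm]
  simp only [← Finset.mul_sum, h3, mul_add, Finset.sum_add_distrib, ← Finset.sum_mul,
    quadraticChar_sum_zero (ringChar_ne_two (F := F) p hp)]
  simp [hq]
  ring

lemma traceCharSum_sq_le (hp : Odd p) (hm : 0 < m) (hF : Fintype.card F = p ^ m) (t : ZMod p) :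
    traceCharSum p F t ^ 2 ≤ (p : ℤ) ^ (m - 1) * (p - 1) := by
  rw [← sum_traceCharSum_sq (F := F) hp hm hF]
  exact Finset.single_le_sum (f := fun t => traceCharSum p F t ^ 2)
    (fun _ _ => sq_nonneg _) (mem_univ t)

end CharSum

/-! ### The character sums for odd degree. -/

section Odd

variable {p : ℕ} [Fact p.Prime] {F : Type*} [Field F] [Fintype F] [DecidableEq F]
  [Algebra (ZMod p) F] {m : ℕ}

/-- In odd degree the quadratic character of `F` restricts to that of the prime field. -/
lemma quadraticChar_algebraMap_of_odd (hp : Odd p) (hm : Odd m) (hF : Fintype.card F = p ^ m)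
    {s : ZMod p} (hs : ¬ IsSquare s) : quadraticChar F (algebraMap (ZMod p) F s) = -1 := by
  have hs0 : s ≠ 0 := by rintro rfl; exact hs (IsSquare.zero)
  rw [quadraticChar_neg_one_iff_not_isSquare]
  rw [FiniteField.isSquare_iff (by rw [ZMod.ringChar_zmod_n]; rintro rfl; exact absurd hp (by decide)) hs0] at hs
  rw [FiniteField.isSquare_iff (ringChar_ne_two p hp) (by simpa using hs0), ← map_pow, hF]
  rw [ZMod.card] at hs
  intro h
  have h' : s ^ (p ^ m / 2) = 1 := by
    apply (algebraMap (ZMod p) F).injective; simpa using h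
  obtain ⟨k, hk⟩ := hp
  have hsq : (s ^ (p / 2)) ^ 2 = 1 := by
    rw [← pow_mul, show p / 2 * 2 = p - 1 by omega]
    exact ZMod.pow_card_sub_one_eq_one hs0
  -- Euler's exponent (p^m - 1)/2 is (p - 1)/2 times a sum of m odd terms. For odd m that factor is
  -- odd, so the sign s^((p-1)/2) is unchanged when raised to it.
  have hge : p ^ m / 2 = (p / 2) * ∑ i ∈ range m, p ^ i := by
    have h1 := Nat.geomSum_eq (m := p) (Fact.out : p.Prime).two_le m
    have h2 : (p - 1) * ∑ i ∈ range m, p ^ i = p ^ m - 1 := by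
      rw [h1]
      exact Nat.mul_div_cancel' (by simpa using Nat.sub_dvd_pow_sub_pow p 1 m)
    have h3 : Odd (p ^ m) := Odd.pow ⟨k, hk⟩
    obtain ⟨l, hl⟩ := h3
    have h4 : p - 1 = 2 * (p / 2) := by omega
    rw [h4, mul_assoc] at h2
    omega
  have hodd : Odd (∑ i ∈ range m, p ^ i) := by
    rw [Finset.odd_sum_iff_odd_card_odd]
    simpa [Finset.filter_true_of_mem, (Odd.pow ⟨k, hk⟩ : ∀ {i}, Odd (p ^ i))] using hm
  obtain ⟨l, hl⟩ := hodd
  rw [hge, hl, pow_mul, pow_add, pow_mul, hsq] at h'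
  exact hs (by simpa using h')

lemma exists_not_isSquare (hp : Odd p) : ∃ s : ZMod p, ¬ IsSquare s :=
  FiniteField.exists_nonsquare
    (by rw [ZMod.ringChar_zmod_n]; rintro rfl; exact absurd hp (by decide))

/-- Scaling by a nonsquare of GF(p) fixes 0 and changes the sign of S. -/
lemma traceCharSum_zero_of_odd (hp : Odd p) (hm : Odd m) (hF : Fintype.card F = p ^ m) :
    traceCharSum p F 0 = 0 := by
  obtain ⟨s, hs⟩ := exists_not_isSquare hp
  have hs0 : s ≠ 0 := by rintro rfl; exact hs (IsSquare.zero)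
  have h := traceCharSum_mul (F := F) hs0 0
  rw [mul_zero, quadraticChar_algebraMap_of_odd hp hm hF hs] at h
  omega

/-- S² is constant off 0 by scaling and vanishes at 0, so the second moment is shared equally by p -
1 arguments. -/
lemma traceCharSum_sq_of_odd (hp : Odd p) (hm : Odd m) (hF : Fintype.card F = p ^ m)
    {t : ZMod p} (ht : t ≠ 0) :
    traceCharSum p F t ^ 2 = (p : ℤ) ^ (m - 1) := by
  have h1 : ∀ t : ZMod p, t ≠ 0 → traceCharSum p F t ^ 2 = traceCharSum p F 1 ^ 2 := by
    intro t ht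
    have h := traceCharSum_mul (F := F) ht 1
    rw [mul_one] at h
    rw [h, mul_pow, sq (quadraticChar F _), quadraticChar_mul_self (by simpa using ht), one_mul]
  have h2 := sum_traceCharSum_sq (F := F) hp hm.pos hF
  rw [← Finset.add_sum_erase _ _ (mem_univ 0), traceCharSum_zero_of_odd hp hm hF,
    Finset.sum_congr rfl (fun t ht => h1 t (Finset.ne_of_mem_erase ht)), Finset.sum_const,
    Finset.card_erase_of_mem (mem_univ _), Finset.card_univ, ZMod.card, nsmul_eq_mul,
    Nat.cast_sub (Fact.out : p.Prime).one_le] at h2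
  have hp1 : ((p : ℤ) - 1) ≠ 0 := by
    have := (Fact.out : p.Prime).two_le
    omega
  rw [h1 t ht]
  apply mul_left_cancel₀ hp1
  push_cast at h2
  linear_combination h2

/-- In odd degree, `traceCharSum` on nonzero arguments takes two opposite values equally often. -/
lemma sum_comp_traceCharSum_of_odd (hp : Odd p) (hm : Odd m) (hF : Fintype.card F = p ^ m)
    {d : ℤ} (hd : d ^ 2 = (p : ℤ) ^ (m - 1)) (ψ : ℤ → ℚ) :
    ∑ t : ZMod p, ψ (traceCharSum p F t) = ψ 0 + ((p : ℚ) - 1) / 2 * (ψ d + ψ (-d)) := by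
  obtain ⟨s, hs⟩ := exists_not_isSquare hp
  have hs0 : s ≠ 0 := by rintro rfl; exact hs (IsSquare.zero)
  have hneg : ∀ t, traceCharSum p F (s * t) = - traceCharSum p F t := fun t => by
    rw [traceCharSum_mul (F := F) hs0 t, quadraticChar_algebraMap_of_odd hp hm hF hs]; ring
  -- Scaling by a nonsquare shows that S and -S are equidistributed. The symmetrised sum no longer
  -- depends on which of d, -d each S(t) is.
  have h1 : ∑ t : ZMod p, ψ (traceCharSum p F t) = ∑ t : ZMod p, ψ (-traceCharSum p F t) := by
    rw [← Equiv.sum_comp (Equiv.mulLeft₀ s hs0)]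
    simp [hneg]
  have h2 : ∑ t : ZMod p, (ψ (traceCharSum p F t) + ψ (-traceCharSum p F t)) =
      2 * ψ 0 + ((p : ℚ) - 1) * (ψ d + ψ (-d)) := by
    have h3 : ∀ t ∈ univ.erase (0 : ZMod p),
        ψ (traceCharSum p F t) + ψ (-traceCharSum p F t) = ψ d + ψ (-d) := by
      intro t ht
      have := traceCharSum_sq_of_odd (F := F) hp hm hF (Finset.ne_of_mem_erase ht)
      rw [← hd, sq_eq_sq_iff_eq_or_eq_neg] at this
      rcases this with h | h
      · rw [h]
      · rw [h, neg_neg, add_comm]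
    rw [← Finset.add_sum_erase _ _ (mem_univ 0), traceCharSum_zero_of_odd hp hm hF,
      Finset.sum_congr rfl h3, Finset.sum_const, Finset.card_erase_of_mem (mem_univ _),
      Finset.card_univ, ZMod.card, nsmul_eq_mul, Nat.cast_sub (Fact.out : p.Prime).one_le]
    push_cast
    rw [neg_zero]
    ring
  rw [Finset.sum_add_distrib, ← h1] at h2
  linarith

end Odd

/-! ### The character sums for even degree. -/

section Even

variable {p : ℕ} [Fact p.Prime] {F : Type*} [Field F] [Fintype F] [DecidableEq F]
  [Algebra (ZMod p) F] {k : ℕ}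

/-- The value at `0` in the presence of a subfield of index `2`. -/
lemma traceCharSum_zero_of_tower (hp : Odd p) (hk : 0 < k) (K : Type*) [Field K] [Fintype K]
    [DecidableEq K] [Algebra (ZMod p) K] [Algebra K F] [IsScalarTower (ZMod p) K F]
    (hK : Fintype.card K = p ^ k) (hF : Fintype.card F = (p ^ k) ^ 2) :
    traceCharSum p F 0 = ((p : ℤ) ^ k - (p : ℤ) ^ (k - 1)) * (-1) ^ ((p ^ k + 1) / 2) := by
  have h2F := ringChar_ne_two (F := F) p hp
  have hQodd : Odd (p ^ k) := hp.pow
  have hQ1 : 1 < p ^ k := Nat.one_lt_pow hk.ne' (Fact.out : p.Prime).one_lt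
  generalize hQ : p ^ k = Q at *
  have hfr : Module.finrank K F = 2 := by
    have := Module.card_eq_pow_finrank (K := K) (V := F)
    rw [hF, hK] at this
    exact (Nat.pow_right_injective hQ1 this).symm
  have htr : ∀ y : F, algebraMap K F (Algebra.trace K F y) = y + y ^ Q := by
    intro y
    rw [FiniteField.algebraMap_trace_eq_sum_pow, hfr, Nat.card_eq_fintype_card, hK]
    simp [Finset.sum_range_succ]
  -- elements of `K` are squares in `F`
  have hsqK : ∀ c : K, c ≠ 0 → quadraticChar F (algebraMap K F c) = 1 := by
    intro c hc
    rw [quadraticChar_one_iff_isSquare (by simpa using hc),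
      FiniteField.isSquare_iff h2F (by simpa using hc), hF]
    obtain ⟨l, hl⟩ := hQodd
    -- Q² is odd, so the truncated quotient is (Q² - 1)/2 = (Q - 1)(Q + 1)/2.
    have : Q ^ 2 / 2 = (Q - 1) * (l + 1) := by
      subst hl
      have : (2 * l + 1) ^ 2 = 2 * ((2 * l) * (l + 1)) + 1 := by ring
      simp only [Nat.add_sub_cancel]
      omega
    rw [this, pow_mul, ← map_pow, ← hK, FiniteField.pow_card_sub_one_eq_one c hc, map_one, one_pow]
  -- the elements of relative trace zero
  have hker : ∀ y : F, y ≠ 0 → Algebra.trace K F y = 0 →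
      quadraticChar F y = (-1) ^ ((Q + 1) / 2) := by
    intro y hy h
    -- Relative trace zero means y + y^Q = 0.
    have h1 : y ^ (Q - 1) = -1 := by
      have h2 := htr y
      rw [h, map_zero] at h2
      apply mul_left_cancel₀ hy
      rw [← pow_succ', Nat.sub_add_cancel hQ1.le]
      linear_combination -h2
    have h3 : ((quadraticChar F y : ℤ) : F) = (((-1) ^ ((Q + 1) / 2) : ℤ) : F) := by
      rw [quadraticChar_eq_pow_of_char_ne_two' h2F, hF]
      obtain ⟨l, hl⟩ := hQodd
      have : Q ^ 2 / 2 = (Q - 1) * ((Q + 1) / 2) := by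
        subst hl
        have : (2 * l + 1) ^ 2 = 2 * ((2 * l) * (l + 1)) + 1 := by ring
        have h5 : (2 * l + 1 + 1) / 2 = l + 1 := by omega
        simp only [Nat.add_sub_cancel, h5]
        omega
      rw [this, pow_mul, h1]
      push_cast
      rfl
    have hone : ((1 : ℤ) : F) ≠ ((-1 : ℤ) : F) := by
      push_cast
      exact (Ring.neg_one_ne_one_of_char_ne_two h2F).symm
    rcases quadraticChar_dichotomy hy with h4 | h4 <;>
    rcases neg_one_pow_eq_or ℤ ((Q + 1) / 2) with h5 | h5 <;> rw [h4, h5] at h3 ⊢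
    · exact absurd h3 hone
    · exact absurd h3.symm hone
  -- the count of elements of relative trace zero
  have hcard : ∑ y : F, (if Algebra.trace K F y = 0 then (1 : ℤ) else 0) = Q := by
    have h := card_fiber_mul_card (Algebra.trace K F).toAddMonoidHom
      (Algebra.trace_surjective K F) 0
    rw [hK, hF, sq] at h
    have h' := Nat.eq_of_mul_eq_mul_right (by omega) h
    rw [Finset.sum_boole]
    exact_mod_cast h'
  have hkersum : ∑ y : F, (if Algebra.trace K F y = 0 then quadraticChar F y else 0) =
      ((Q : ℤ) - 1) * (-1) ^ ((Q + 1) / 2) := by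
    have : ∀ y : F, (if Algebra.trace K F y = 0 then quadraticChar F y else 0) =
        ((if Algebra.trace K F y = 0 then 1 else 0) - if y = 0 then 1 else 0) *
          (-1) ^ ((Q + 1) / 2) := by
      intro y
      by_cases hy : y = 0
      · simp [hy]
      · by_cases h : Algebra.trace K F y = 0
        · simp [h, hy, hker y hy h]
        · simp [h, hy]
    rw [Finset.sum_congr rfl fun y _ => this y, ← Finset.sum_mul, Finset.sum_sub_distrib, hcard]
    simp
  -- average over multiplication by the nonzero elements of `K`
  have h1 : ∀ c : K, c ≠ 0 → traceCharSum p F 0 = ∑ y : F,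
      quadraticChar F y * if Algebra.trace (ZMod p) K (Algebra.trace K F y * c) = 0 then 1 else 0 := by
    intro c hc
    have h := sum_trace_mul_char (F := F) (p := p) (a := algebraMap K F c) (by simpa using hc) 0
    rw [hsqK c hc, one_mul] at h
    rw [← h]
    refine Finset.sum_congr rfl fun y _ => ?_
    rw [← Algebra.smul_def, ← Algebra.trace_trace (S := K), map_smul, smul_eq_mul, mul_comm c]
    simp
  -- The count depends on d only through d = 0. Since Ση(y) = 0, after averaging only the y of
  -- relative trace zero contribute.
  have hd : ∀ d : K, ∑ c ∈ univ.erase (0 : K),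
      (if Algebra.trace (ZMod p) K (d * c) = 0 then (1 : ℤ) else 0) =
      ((p : ℤ) ^ (k - 1) - 1) + if d = 0 then (Q : ℤ) - (p : ℤ) ^ (k - 1) else 0 := by
    intro d
    have := Finset.add_sum_erase univ
      (fun c : K => if Algebra.trace (ZMod p) K (d * c) = 0 then (1 : ℤ) else 0) (mem_univ 0)
    simp only [mul_zero, map_zero, if_true] at this
    by_cases hd : d = 0
    · simp [hd, hK] at this ⊢
      linarith
    · rw [sum_trace_mul_eq hk (hK.trans hQ.symm) hd] at this
      simp only [hd, if_false]
      linarith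
  have h2 : ((Q : ℤ) - 1) * traceCharSum p F 0 =
      ((Q : ℤ) - (p : ℤ) ^ (k - 1)) * (((Q : ℤ) - 1) * (-1) ^ ((Q + 1) / 2)) := by
    have e1 : ∑ c ∈ univ.erase (0 : K), traceCharSum p F 0 =
        ((Q : ℤ) - 1) * traceCharSum p F 0 := by
      rw [Finset.sum_const, Finset.card_erase_of_mem (mem_univ _), Finset.card_univ, hK,
        nsmul_eq_mul, Nat.cast_sub hQ1.le]
      simp
    rw [← e1, Finset.sum_congr rfl fun c hc => h1 c (Finset.ne_of_mem_erase hc), Finset.sum_comm]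
    simp only [← Finset.mul_sum, hd, mul_add, Finset.sum_add_distrib, ← Finset.sum_mul,
      quadraticChar_sum_zero h2F, zero_mul, zero_add]
    rw [← hkersum, Finset.mul_sum]
    exact Finset.sum_congr rfl fun y _ => by split_ifs <;> ring
  have hQz : ((Q : ℤ) - 1) ≠ 0 := by omega
  have hQc : (p : ℤ) ^ k = Q := by exact_mod_cast hQ
  rw [hQc]
  apply mul_left_cancel₀ hQz
  rw [h2]
  ring

lemma neg_one_pow_half_pow (hp : Odd p) (k : ℕ) :
    (-1 : ℤ) ^ ((p ^ k + 1) / 2) = -(-1) ^ (k * ((p - 1) / 2)) := by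
  obtain ⟨l, rfl⟩ := hp
  -- Here j = (p^k - 1)/2, and only its parity matters; (2j + 1)(2l + 1) = 2(j + l + 2jl) + 1 makes
  -- it additive modulo 2.
  have key : ∀ k : ℕ, ∃ j : ℕ, (2 * l + 1) ^ k = 2 * j + 1 ∧ (-1 : ℤ) ^ j = (-1) ^ (k * l) := by
    intro k
    induction k with
    | zero => exact ⟨0, by simp⟩
    | succ k ih =>
      obtain ⟨j, hj, hj'⟩ := ih
      refine ⟨j + l + 2 * (j * l), by rw [pow_succ, hj]; ring, ?_⟩
      rw [pow_add, pow_add, pow_mul, hj', add_mul, pow_add]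
      simp
  obtain ⟨j, hj, hj'⟩ := key k
  rw [hj, show (2 * j + 1 + 1) / 2 = j + 1 by omega, show (2 * l + 1 - 1) / 2 = l by omega,
    pow_succ, hj']
  ring

/-- GF(p^k) embeds in F because k divides m = 2k, so the tower computation applies; the rest matches
the signs. -/
lemma traceCharSum_zero_of_even {m : ℕ} (hp : Odd p) (hm0 : 0 < m) (hm : Even m)
    (hF : Fintype.card F = p ^ m) :
    traceCharSum p F 0 =
      -(((p : ℤ) - 1) * ((p : ℤ) ^ ((m - 2) / 2) * (-1) ^ (m * (p - 1) / 4))) := by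
  obtain ⟨k, rfl⟩ := hm
  have hk : 0 < k := by omega
  have hfK := GaloisField.finrank p hk.ne'
  have hfF : Module.finrank (ZMod p) F = k + k := by
    have := Module.card_eq_pow_finrank (K := ZMod p) (V := F)
    rw [hF, ZMod.card] at this
    exact (Nat.pow_right_injective (Fact.out : p.Prime).two_le this).symm
  obtain ⟨f⟩ := FiniteField.nonempty_algHom_of_finrank_dvd (F := ZMod p) (K := GaloisField p k)
    (L := F) (by rw [hfK, hfF]; exact ⟨2, by ring⟩)
  let _ : Algebra (GaloisField p k) F := f.toRingHom.toAlgebra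
  have : IsScalarTower (ZMod p) (GaloisField p k) F :=
    IsScalarTower.of_algebraMap_eq fun x => (f.commutes x).symm
  classical
  let _ : Fintype (GaloisField p k) := Fintype.ofFinite _
  have hcK : Fintype.card (GaloisField p k) = p ^ k := by
    rw [← Nat.card_eq_fintype_card, GaloisField.card p k hk.ne']
  rw [traceCharSum_zero_of_tower hp hk (GaloisField p k) hcK (by rw [hF]; ring),
    neg_one_pow_half_pow hp]
  have e1 : (k + k - 2) / 2 = k - 1 := by omega
  have e2 : (k + k) * (p - 1) / 4 = k * ((p - 1) / 2) := by
    obtain ⟨l, rfl⟩ := hp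
    have h1 : (k + k) * (2 * l + 1 - 1) = 4 * (k * l) := by
      rw [Nat.add_sub_cancel]; ring
    rw [h1, show (2 * l + 1 - 1) / 2 = l by omega]
    omega
  have e3 : (p : ℤ) ^ k = p * (p : ℤ) ^ (k - 1) := by
    rw [← pow_succ', Nat.sub_add_cancel hk]
  rw [e1, e2, e3]
  ring

/-- Every element of GF(p)* is a square in F, so S is constant off 0; ΣS(t) = 0 and S(0) determine
that constant. -/
lemma traceCharSum_of_even {m : ℕ} (hp : Odd p) (hm0 : 0 < m) (hm : Even m)
    (hF : Fintype.card F = p ^ m) {t : ZMod p} (ht : t ≠ 0) :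
    traceCharSum p F t = (p : ℤ) ^ ((m - 2) / 2) * (-1) ^ (m * (p - 1) / 4) := by
  have hsq : ∀ s : ZMod p, s ≠ 0 → quadraticChar F (algebraMap (ZMod p) F s) = 1 := by
    intro s hs
    have hs' : algebraMap (ZMod p) F s ≠ 0 := by simpa using hs
    rw [quadraticChar_one_iff_isSquare hs',
      FiniteField.isSquare_iff (ringChar_ne_two p hp) hs', hF]
    obtain ⟨k, rfl⟩ := hm
    obtain ⟨l, hl⟩ := hp
    obtain ⟨j, hj⟩ : (p - 1) ∣ p ^ k - 1 := by simpa using Nat.sub_dvd_pow_sub_pow p 1 k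
    have hodd : Odd (p ^ k) := Odd.pow ⟨l, hl⟩
    obtain ⟨i, hi⟩ := hodd
    have : p ^ (k + k) / 2 = (p - 1) * (j * (i + 1)) := by
      rw [← mul_assoc, ← hj, pow_add, hi, Nat.add_sub_cancel,
        show (2 * i + 1) * (2 * i + 1) = 2 * (2 * i * (i + 1)) + 1 by ring]
      omega
    rw [this, pow_mul, ← map_pow, ZMod.pow_card_sub_one_eq_one hs, map_one, one_pow]
  have h1 : ∀ s : ZMod p, s ≠ 0 → traceCharSum p F s = traceCharSum p F 1 := by
    intro s hs
    have := traceCharSum_mul (F := F) hs 1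
    rwa [hsq s hs, mul_one, one_mul] at this
  have h2 := sum_traceCharSum (F := F) hp
  rw [← Finset.add_sum_erase _ _ (mem_univ 0), traceCharSum_zero_of_even hp hm0 hm hF,
    Finset.sum_congr rfl (fun t ht => h1 t (Finset.ne_of_mem_erase ht)), Finset.sum_const,
    Finset.card_erase_of_mem (mem_univ _), Finset.card_univ, ZMod.card, nsmul_eq_mul,
    Nat.cast_sub (Fact.out : p.Prime).one_le] at h2
  have hp1 : ((p : ℤ) - 1) ≠ 0 := by
    have := (Fact.out : p.Prime).two_le
    omega
  rw [h1 t ht]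
  apply mul_left_cancel₀ hp1
  push_cast at h2
  linear_combination h2

lemma sum_comp_traceCharSum_of_even {m : ℕ} (hp : Odd p) (hm0 : 0 < m) (hm : Even m)
    (hF : Fintype.card F = p ^ m) {e : ℤ}
    (he : e = (p : ℤ) ^ ((m - 2) / 2) * (-1) ^ (m * (p - 1) / 4)) (ψ : ℤ → ℚ) :
    ∑ t : ZMod p, ψ (traceCharSum p F t) = ψ (-((p - 1) * e)) + ((p : ℚ) - 1) * ψ e := by
  rw [← Finset.add_sum_erase _ _ (mem_univ 0), traceCharSum_zero_of_even hp hm0 hm hF, ← he,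
    Finset.sum_congr rfl (fun t ht => by
      rw [traceCharSum_of_even hp hm0 hm hF (Finset.ne_of_mem_erase ht), ← he]),
    Finset.sum_const, Finset.card_erase_of_mem (mem_univ _), Finset.card_univ, ZMod.card,
    nsmul_eq_mul, Nat.cast_sub (Fact.out : p.Prime).one_le]
  simp

end Even

/-! ### Weights of codewords and sums over the code. -/

section Weight

variable {p : ℕ} [Fact p.Prime] {F : Type*} [Field F] [Fintype F] [Algebra (ZMod p) F] {m : ℕ}

/-- The contribution `0` or `1` of a coordinate to the Hamming weight. -/
def nonzeroInd (t : ZMod p) : ℤ := if t = 0 then 0 else 1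

lemma nonzeroInd_nonneg (t : ZMod p) : 0 ≤ nonzeroInd t := by
  unfold nonzeroInd; split_ifs <;> norm_num

lemma hammingNorm_codeword (hF : Fintype.card F = p ^ m) (a b : F) (c : ZMod p) :
    (hammingNorm (codeword p F a b c) : ℤ) = (p : ℤ) ^ m -
      ∑ x : F, (if Algebra.trace (ZMod p) F (a * x ^ 2 + b * x) + c = 0 then (1 : ℤ) else 0) +
      nonzeroInd (Algebra.trace (ZMod p) F a) + nonzeroInd (Algebra.trace (ZMod p) F b) := by
  have hq : (p : ℤ) ^ m = ∑ _x : F, (1 : ℤ) := by simp [hF]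
  rw [hammingNorm, ← Finset.sum_boole, Fintype.sum_sum_type, hq, ← Finset.sum_sub_distrib,
    Fin.sum_univ_two, add_assoc]
  congr 1
  · refine Finset.sum_congr rfl fun x _ => ?_
    simp only [codeword, Sum.elim_inl]
    split_ifs <;> simp_all
  · simp [codeword, nonzeroInd]

lemma hammingNorm_codeword_const (hF : Fintype.card F = p ^ m) (c : ZMod p) :
    (hammingNorm (codeword p F 0 0 c) : ℤ) = if c = 0 then 0 else (p : ℤ) ^ m := by
  rw [hammingNorm_codeword hF]
  by_cases hc : c = 0 <;> simp [hc, nonzeroInd, hF]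

lemma hammingNorm_codeword_linear (hm : 0 < m) (hF : Fintype.card F = p ^ m) {b : F}
    (hb : b ≠ 0) (c : ZMod p) :
    (hammingNorm (codeword p F 0 b c) : ℤ) =
      (p : ℤ) ^ (m - 1) * (p - 1) + nonzeroInd (Algebra.trace (ZMod p) F b) := by
  rw [hammingNorm_codeword hF]
  simp only [zero_mul, zero_add, map_zero, add_eq_zero_iff_eq_neg]
  rw [sum_trace_mul_eq hm hF hb]
  obtain ⟨n, rfl⟩ : ∃ n, m = n + 1 := ⟨m - 1, by omega⟩
  simp [nonzeroInd, pow_succ]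
  ring

lemma hammingNorm_codeword_quadratic [DecidableEq F] (hp : Odd p) (hm : 0 < m)
    (hF : Fintype.card F = p ^ m) {a : F} (ha : a ≠ 0) (b : F) (c : ZMod p) :
    (hammingNorm (codeword p F a b c) : ℤ) = (p : ℤ) ^ (m - 1) * (p - 1) -
      quadraticChar F a *
        traceCharSum p F (Algebra.trace (ZMod p) F (b ^ 2 / (4 * a)) - c) +
      nonzeroInd (Algebra.trace (ZMod p) F a) + nonzeroInd (Algebra.trace (ZMod p) F b) := by
  have h2 : (2 : F) ≠ 0 := Ring.two_ne_zero (ringChar_ne_two p hp)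
  have h4 : (4 : F) ≠ 0 := by
    rw [show (4 : F) = 2 * 2 by norm_num]; exact mul_ne_zero h2 h2
  have h := sum_trace_mul_sq (F := F) hp hm hF ha
    (Algebra.trace (ZMod p) F (b ^ 2 / (4 * a)) - c)
  -- The translation by b/(2a) completes the square.
  rw [← Equiv.sum_comp (Equiv.addRight (b / (2 * a)))] at h
  have hq : (p : ℤ) ^ m = p * (p : ℤ) ^ (m - 1) := by
    rw [← pow_succ', Nat.sub_add_cancel hm]
  have h3 : ∀ x : F, a * (x + b / (2 * a)) ^ 2 = (a * x ^ 2 + b * x) + b ^ 2 / (4 * a) := by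
    intro x
    field_simp
    ring
  simp only [Equiv.coe_addRight, h3, map_add] at h
  rw [hammingNorm_codeword hF]
  have h5 : ∀ x : F, (Algebra.trace (ZMod p) F (a * x ^ 2 + b * x) + c = 0) ↔
      (Algebra.trace (ZMod p) F (a * x ^ 2) + Algebra.trace (ZMod p) F (b * x) +
        Algebra.trace (ZMod p) F (b ^ 2 / (4 * a)) =
        Algebra.trace (ZMod p) F (b ^ 2 / (4 * a)) - c) := by
    intro x
    rw [map_add]
    constructor <;> intro h
    · linear_combination h
    · linear_combination h
  simp only [h5]
  rw [h, hq]
  ring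

/-- The second moment gives S² ≤ N, and N < N² because N ≥ 2. This crude bound keeps every weight
with a ≠ 0 positive. -/
lemma abs_traceCharSum_lt [DecidableEq F] (hp : Odd p) (hm : 0 < m)
    (hF : Fintype.card F = p ^ m) (t : ZMod p) :
    |traceCharSum p F t| < (p : ℤ) ^ (m - 1) * (p - 1) := by
  have h := traceCharSum_sq_le (F := F) hp hm hF t
  have hp3 : 3 ≤ p := by
    have := (Fact.out : p.Prime).two_le
    obtain ⟨l, rfl⟩ := hp
    omega
  have hp3' : (3 : ℤ) ≤ p := by exact_mod_cast hp3
  have h1 : (1 : ℤ) ≤ (p : ℤ) ^ (m - 1) := one_le_pow₀ (by omega)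
  have hN : 2 ≤ (p : ℤ) ^ (m - 1) * (p - 1) := by nlinarith
  apply abs_lt_of_sq_lt_sq _ (by omega)
  nlinarith

lemma quadraticChar_mul_le_abs [DecidableEq F] {a : F} (ha : a ≠ 0) (s : ℤ) :
    quadraticChar F a * s ≤ |s| := by
  rcases quadraticChar_dichotomy ha with h | h <;> rw [h]
  · simpa using le_abs_self s
  · simpa using neg_le_abs s

omit [Fintype F] in
lemma codeword_sub (a b a' b' : F) (c c' : ZMod p) :
    codeword p F a b c - codeword p F a' b' c' = codeword p F (a - a') (b - b') (c - c') := by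
  funext i
  rcases i with x | i
  · simp only [codeword, Pi.sub_apply, Sum.elim_inl, sub_mul, map_add, map_sub]
    ring
  · fin_cases i <;> simp [codeword]

lemma codeword_eq_zero (hp : Odd p) (hm : 0 < m) (hF : Fintype.card F = p ^ m) {a b : F}
    {c : ZMod p} (h : codeword p F a b c = 0) : a = 0 ∧ b = 0 ∧ c = 0 := by
  classical
  have h0 : (hammingNorm (codeword p F a b c) : ℤ) = 0 := by rw [h]; simp
  have hNpos := (abs_nonneg _).trans_lt (abs_traceCharSum_lt (F := F) hp hm hF 0)
  by_cases ha : a = 0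
  · subst ha
    by_cases hb : b = 0
    · subst hb
      rw [hammingNorm_codeword_const hF] at h0
      refine ⟨rfl, rfl, ?_⟩
      by_contra hc
      simp [hc, hm.ne', (Fact.out : p.Prime).ne_zero] at h0
    · rw [hammingNorm_codeword_linear hm hF hb] at h0
      have := nonzeroInd_nonneg (Algebra.trace (ZMod p) F b)
      omega
  · rw [hammingNorm_codeword_quadratic hp hm hF ha] at h0
    have h1 := nonzeroInd_nonneg (Algebra.trace (ZMod p) F b)
    have h2 := nonzeroInd_nonneg (Algebra.trace (ZMod p) F a)
    have h3 := abs_traceCharSum_lt (F := F) hp hm hF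
      (Algebra.trace (ZMod p) F (b ^ 2 / (4 * a)) - c)
    have h4 := quadraticChar_mul_le_abs ha
      (traceCharSum p F (Algebra.trace (ZMod p) F (b ^ 2 / (4 * a)) - c))
    omega

lemma codeword_injective (hp : Odd p) (hm : 0 < m) (hF : Fintype.card F = p ^ m) :
    Function.Injective (fun v : F × F × ZMod p => codeword p F v.1 v.2.1 v.2.2) := by
  rintro ⟨a, b, c⟩ ⟨a', b', c'⟩ h
  have h' := sub_eq_zero.mpr h
  simp only [codeword_sub] at h'
  obtain ⟨h1, h2, h3⟩ := codeword_eq_zero hp hm hF h'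
  rw [sub_eq_zero.mp h1, sub_eq_zero.mp h2, sub_eq_zero.mp h3]

lemma finrank_code (hp : Odd p) (hm : 0 < m) (hF : Fintype.card F = p ^ m) :
    Module.finrank (ZMod p) (code p F) = 2 * m + 1 := by
  have h1 : Nat.card (code p F) = p ^ (2 * m + 1) := by
    have hr : (code p F : Set (F ⊕ Fin 2 → ZMod p)) =
        Set.range (fun v : F × F × ZMod p => codeword p F v.1 v.2.1 v.2.2) := by
      ext w
      constructor
      · rintro ⟨a, b, c, rfl⟩; exact ⟨(a, b, c), rfl⟩
      · rintro ⟨⟨a, b, c⟩, rfl⟩; exact ⟨a, b, c, rfl⟩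
    change Nat.card (code p F : Set (F ⊕ Fin 2 → ZMod p)) = _
    rw [hr, Nat.card_range_of_injective (codeword_injective hp hm hF), Nat.card_eq_fintype_card,
      Fintype.card_prod, Fintype.card_prod, ZMod.card, hF]
    ring
  have h2 := Module.natCard_eq_pow_finrank (K := ZMod p) (V := code p F)
  rw [h1, Nat.card_zmod] at h2
  exact (Nat.pow_right_injective (Fact.out : p.Prime).two_le h2).symm

/-- The least weight of a nonzero codeword is the minimum distance. -/
lemma hasMinDist_code {d : ℕ} (hd : 0 < d)
    (hex : ∃ a b : F, ∃ c : ZMod p, hammingNorm (codeword p F a b c) = d)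
    (hle : ∀ (a b : F) (c : ZMod p), ¬ (a = 0 ∧ b = 0 ∧ c = 0) →
      d ≤ hammingNorm (codeword p F a b c)) :
    HasMinDist (code p F) d := by
  constructor
  · obtain ⟨a, b, c, h⟩ := hex
    refine ⟨_, ⟨a, b, c, rfl⟩, 0, Submodule.zero_mem _, ?_, ?_⟩
    · intro h0
      rw [h0, hammingNorm_zero] at h
      omega
    · rw [hammingDist_zero_right, h]
  · rintro r ⟨_, ⟨a, b, c, rfl⟩, _, ⟨a', b', c', rfl⟩, hne, rfl⟩
    rw [hammingDist_eq_hammingNorm, neg_add_eq_sub, codeword_sub]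
    apply hle
    rintro ⟨h1, h2, h3⟩
    rw [sub_eq_zero.mp h1, sub_eq_zero.mp h2, sub_eq_zero.mp h3] at hne
    exact hne rfl

lemma sum_comp_nonzeroInd_trace (hm : 0 < m) (hF : Fintype.card F = p ^ m) (φ : ℤ → ℚ) :
    ∑ b : F, φ (nonzeroInd (Algebra.trace (ZMod p) F b)) =
      (p : ℚ) ^ (m - 1) * φ 0 + ((p : ℚ) ^ m - (p : ℚ) ^ (m - 1)) * φ 1 := by
  have h1 : ∀ b : F, φ (nonzeroInd (Algebra.trace (ZMod p) F b)) =
      (((if Algebra.trace (ZMod p) F b = 0 then (1 : ℤ) else 0) : ℤ) : ℚ) * (φ 0 - φ 1) + φ 1 := by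
    intro b
    unfold nonzeroInd
    split_ifs <;> simp
  rw [Finset.sum_congr rfl fun b _ => h1 b, Finset.sum_add_distrib, ← Finset.sum_mul,
    ← Int.cast_sum, sum_trace_eq hm hF]
  simp [hF]
  ring

/-- The joint distribution of the quadratic character and the vanishing of the trace. -/
lemma sum_comp_quadraticChar_nonzeroInd [DecidableEq F] (hp : Odd p) (hm : 0 < m)
    (hF : Fintype.card F = p ^ m) (ψ : ℤ → ℤ → ℚ) :
    ∑ a ∈ univ.erase (0 : F), ψ (quadraticChar F a) (nonzeroInd (Algebra.trace (ZMod p) F a)) =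
      ((p : ℚ) ^ (m - 1) - 1 + traceCharSum p F 0) / 2 * ψ 1 0 +
      ((p : ℚ) ^ (m - 1) - 1 - traceCharSum p F 0) / 2 * ψ (-1) 0 +
      ((p : ℚ) ^ m - (p : ℚ) ^ (m - 1) - traceCharSum p F 0) / 2 * ψ 1 1 +
      ((p : ℚ) ^ m - (p : ℚ) ^ (m - 1) + traceCharSum p F 0) / 2 * ψ (-1) 1 := by
  -- Interpolation of ψ on {1, -1} × {0, 1}: the terms involve η, the trace indicator and their
  -- product, and only the product brings in S(0).
  have h1 : ∀ a ∈ univ.erase (0 : F),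
      ψ (quadraticChar F a) (nonzeroInd (Algebra.trace (ZMod p) F a)) =
      (ψ 1 (nonzeroInd (Algebra.trace (ZMod p) F a)) +
        ψ (-1) (nonzeroInd (Algebra.trace (ZMod p) F a))) / 2 +
      (quadraticChar F a : ℚ) * (ψ 1 1 - ψ (-1) 1) / 2 +
      (((if Algebra.trace (ZMod p) F a = 0 then quadraticChar F a else 0) : ℤ) : ℚ) *
        (ψ 1 0 - ψ (-1) 0 - (ψ 1 1 - ψ (-1) 1)) / 2 := by
    intro a ha
    unfold nonzeroInd
    rcases quadraticChar_dichotomy (Finset.ne_of_mem_erase ha) with h | h <;> rw [h] <;>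
      split_ifs <;> push_cast <;> ring
  rw [Finset.sum_congr rfl h1, Finset.sum_erase_eq_sub (mem_univ _)]
  simp only [Finset.sum_add_distrib, ← Finset.sum_div, ← Finset.sum_mul, ← Int.cast_sum,
    quadraticChar_sum_zero (ringChar_ne_two (F := F) p hp)]
  rw [sum_comp_nonzeroInd_trace hm hF (fun t => ψ 1 t),
    sum_comp_nonzeroInd_trace hm hF (fun t => ψ (-1) t), ← traceCharSum]
  simp [nonzeroInd]
  ring

/-- The weight enumerator of the code in terms of `traceCharSum`, tested against `φ`. -/
lemma sum_comp_hammingNorm [DecidableEq F] (hp : Odd p) (hm : 0 < m)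
    (hF : Fintype.card F = p ^ m) {N : ℤ} (hN : N = (p : ℤ) ^ (m - 1) * (p - 1)) (φ : ℤ → ℚ) :
    ∑ a : F, ∑ b : F, ∑ c : ZMod p, φ (hammingNorm (codeword p F a b c)) =
      φ 0 + ((p : ℚ) - 1) * φ ((p : ℤ) ^ m) +
      p * (((p : ℚ) ^ (m - 1) - 1) * φ N + ((p : ℚ) ^ m - (p : ℚ) ^ (m - 1)) * φ (N + 1)) +
      ∑ t : ZMod p, ∑ a ∈ univ.erase (0 : F),
        ((p : ℚ) ^ (m - 1) * φ (N - quadraticChar F a * traceCharSum p F t +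
            nonzeroInd (Algebra.trace (ZMod p) F a)) +
          ((p : ℚ) ^ m - (p : ℚ) ^ (m - 1)) * φ (N - quadraticChar F a * traceCharSum p F t +
            nonzeroInd (Algebra.trace (ZMod p) F a) + 1)) := by
  rw [← Finset.add_sum_erase _ _ (mem_univ (0 : F))]
  congr 1
  · rw [← Finset.add_sum_erase _ _ (mem_univ (0 : F))]
    have hc : ∑ c : ZMod p, φ (hammingNorm (codeword p F 0 0 c)) =
        φ 0 + ((p : ℚ) - 1) * φ ((p : ℤ) ^ m) := by
      rw [← Finset.add_sum_erase _ _ (mem_univ (0 : ZMod p)),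
        Finset.sum_congr rfl (fun c hc => by
          rw [hammingNorm_codeword_const hF, if_neg (Finset.ne_of_mem_erase hc)]),
        hammingNorm_codeword_const hF, Finset.sum_const, Finset.card_erase_of_mem (mem_univ _),
        Finset.card_univ, ZMod.card, nsmul_eq_mul, Nat.cast_sub (Fact.out : p.Prime).one_le]
      simp
    rw [hc]
    congr 1
    rw [Finset.sum_congr rfl (fun b hb => Finset.sum_congr rfl fun c _ => by
      rw [hammingNorm_codeword_linear hm hF (Finset.ne_of_mem_erase hb), ← hN])]
    simp only [Finset.sum_const, Finset.card_univ, ZMod.card, nsmul_eq_mul, ← Finset.mul_sum]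
    rw [Finset.sum_erase_eq_sub (mem_univ _),
      sum_comp_nonzeroInd_trace hm hF (fun t => φ (N + t))]
    congr 1
    simp [nonzeroInd]
    ring
  · refine Eq.trans ?_ Finset.sum_comm
    refine Finset.sum_congr rfl fun a ha => ?_
    have ha' := Finset.ne_of_mem_erase ha
    have h1 : ∀ b : F, ∑ c : ZMod p, φ (hammingNorm (codeword p F a b c)) =
        ∑ t : ZMod p, φ (N - quadraticChar F a * traceCharSum p F t +
          nonzeroInd (Algebra.trace (ZMod p) F a) + nonzeroInd (Algebra.trace (ZMod p) F b)) := by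
      intro b
      -- The bijection c ↦ Tr(b²/(4a)) - c removes the dependence on b from the argument of S.
      rw [← Equiv.sum_comp (Equiv.subLeft (Algebra.trace (ZMod p) F (b ^ 2 / (4 * a))))]
      refine Finset.sum_congr rfl fun c _ => ?_
      rw [hammingNorm_codeword_quadratic hp hm hF ha', hN, Equiv.subLeft_apply]
      simp
    rw [Finset.sum_congr rfl fun b _ => h1 b, Finset.sum_comm]
    refine Finset.sum_congr rfl fun t _ => ?_
    rw [sum_comp_nonzeroInd_trace hm hF (fun s => φ (N - quadraticChar F a * traceCharSum p F t +
          nonzeroInd (Algebra.trace (ZMod p) F a) + s))]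
    simp

/-- Written as a sum over all rows tested against an indicator, the multiplicity needs no case
distinction when rows share a weight. -/
lemma sum_filter_map_snd (T : List (ℤ × ℚ)) (w : ℤ) :
    ((T.filter (fun r => r.1 = w)).map Prod.snd).sum =
      (T.map fun r => r.2 * if r.1 = w then 1 else 0).sum := by
  induction T with
  | nil => simp
  | cons r T ih => by_cases h : r.1 = w <;> simp [h, ih]

/-- To know the weight distribution is to know all sums of functions of the weight. -/
lemma hasWeightDistribution_code (hp : Odd p) (hm : 0 < m) (hF : Fintype.card F = p ^ m)
    {T : List (ℤ × ℚ)} (h : ∀ φ : ℤ → ℚ,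
      ∑ a : F, ∑ b : F, ∑ c : ZMod p, φ (hammingNorm (codeword p F a b c)) =
        (T.map fun r => r.2 * φ r.1).sum) :
    HasWeightDistribution (code p F) T := by
  intro w
  rw [sum_filter_map_snd, ← h (fun n => if n = w then 1 else 0)]
  have hs : {c : F ⊕ Fin 2 → ZMod p | c ∈ code p F ∧ (hammingNorm c : ℤ) = w} =
      (fun v : F × F × ZMod p => codeword p F v.1 v.2.1 v.2.2) ''
        ((({v | (hammingNorm (codeword p F v.1 v.2.1 v.2.2) : ℤ) = w} :
          Finset (F × F × ZMod p)) : Set (F × F × ZMod p))) := by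
    ext u
    constructor
    · rintro ⟨⟨a, b, c, rfl⟩, hw⟩
      exact ⟨(a, b, c), by simpa using hw, rfl⟩
    · rintro ⟨⟨a, b, c⟩, hw, rfl⟩
      exact ⟨⟨a, b, c, rfl⟩, by simpa using hw⟩
  rw [hs, Set.ncard_image_of_injective _ (codeword_injective hp hm hF), Set.ncard_coe_finset,
    Finset.natCast_card_filter, Fintype.sum_prod_type]
  simp only [Fintype.sum_prod_type]

end Weight

/-! ### Weight distributions and parameters of the code. -/

section Main

variable {p : ℕ} [Fact p.Prime] {F : Type*} [Field F] [Fintype F] [Algebra (ZMod p) F] {m : ℕ}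

lemma hasWeightDistribution_of_odd (hp : Odd p) (hm : Odd m) (hF : Fintype.card F = p ^ m) :
    HasWeightDistribution (code p F) (tableOdd p m) := by
  classical
  refine hasWeightDistribution_code hp hm.pos hF fun φ => ?_
  rw [sum_comp_hammingNorm hp hm.pos hF rfl φ]
  have hq : (p : ℚ) ^ m = p * (p : ℚ) ^ (m - 1) := by
    rw [← pow_succ', Nat.sub_add_cancel hm.pos]
  have hqq : (p : ℚ) ^ (2 * m - 2) = ((p : ℚ) ^ (m - 1)) ^ 2 := by
    rw [← pow_mul]; congr 1; omega
  -- Only D² = p^(m-1) is needed: the table is symmetric under D ↦ -D, so the sign of D is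
  -- immaterial.
  have hd : ((p : ℤ) ^ ((m - 1) / 2) * (-1) ^ ((p - 1) * (m + 1) / 4)) ^ 2 =
      (p : ℤ) ^ (m - 1) := by
    rw [mul_pow, ← pow_mul, ← pow_mul, mul_comm _ 2, mul_comm _ 2, pow_mul (-1 : ℤ)]
    obtain ⟨k, rfl⟩ := hm
    simp
  simp only [tableOdd, List.map_cons, List.map_nil, List.sum_cons, List.sum_nil]
  generalize (p : ℤ) ^ ((m - 1) / 2) * (-1) ^ ((p - 1) * (m + 1) / 4) = d at *
  have hin : ∀ t : ZMod p, _ := fun t =>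
    sum_comp_quadraticChar_nonzeroInd (F := F) hp hm.pos hF (fun η τ =>
      (p : ℚ) ^ (m - 1) * φ ((p : ℤ) ^ (m - 1) * (p - 1) - η * traceCharSum p F t + τ) +
          ((p : ℚ) ^ m - (p : ℚ) ^ (m - 1)) *
            φ ((p : ℤ) ^ (m - 1) * (p - 1) - η * traceCharSum p F t + τ + 1))
  rw [Finset.sum_congr rfl fun t _ => hin t]
  have ht := sum_comp_traceCharSum_of_odd (F := F) hp hm hF hd
  generalize (p : ℤ) ^ (m - 1) * ((p : ℤ) - 1) = N at *
  have h0 := traceCharSum_zero_of_odd (F := F) hp hm hF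
  simp only [h0]
  rw [ht (fun s => ((p : ℚ) ^ (m - 1) - 1 + (0 : ℤ)) / 2 *
      ((p : ℚ) ^ (m - 1) * φ (N - 1 * s + 0) +
        ((p : ℚ) ^ m - (p : ℚ) ^ (m - 1)) * φ (N - 1 * s + 0 + 1)) +
    ((p : ℚ) ^ (m - 1) - 1 - (0 : ℤ)) / 2 *
      ((p : ℚ) ^ (m - 1) * φ (N - -1 * s + 0) +
        ((p : ℚ) ^ m - (p : ℚ) ^ (m - 1)) * φ (N - -1 * s + 0 + 1)) +
    ((p : ℚ) ^ m - (p : ℚ) ^ (m - 1) - (0 : ℤ)) / 2 *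
      ((p : ℚ) ^ (m - 1) * φ (N - 1 * s + 1) +
        ((p : ℚ) ^ m - (p : ℚ) ^ (m - 1)) * φ (N - 1 * s + 1 + 1)) +
    ((p : ℚ) ^ m - (p : ℚ) ^ (m - 1) + (0 : ℤ)) / 2 *
      ((p : ℚ) ^ (m - 1) * φ (N - -1 * s + 1) +
        ((p : ℚ) ^ m - (p : ℚ) ^ (m - 1)) * φ (N - -1 * s + 1 + 1)))]
  have hadd : ∀ n : ℤ, n + 1 + 1 = n + 2 := fun n => by ring
  simp only [one_mul, neg_mul, sub_neg_eq_add, add_zero, sub_zero, neg_neg,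
    neg_zero, hadd, hq, hqq]
  generalize (p : ℤ) ^ m = n at *
  push_cast
  ring

lemma hasWeightDistribution_of_even (hp : Odd p) (hm0 : 0 < m) (hm : Even m)
    (hF : Fintype.card F = p ^ m) :
    HasWeightDistribution (code p F) (tableEven p m) := by
  classical
  refine hasWeightDistribution_code hp hm0 hF fun φ => ?_
  rw [sum_comp_hammingNorm hp hm0 hF rfl φ]
  have hq : (p : ℚ) ^ m = p * (p : ℚ) ^ (m - 1) := by
    rw [← pow_succ', Nat.sub_add_cancel hm0]
  have hR : (p : ℚ) ^ ((m - 2) / 2) * (-1) ^ (m * (p - 1) / 4) =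
      (((p : ℤ) ^ ((m - 2) / 2) * (-1) ^ (m * (p - 1) / 4) : ℤ) : ℚ) := by push_cast; rfl
  simp only [tableEven, List.map_cons, List.map_nil, List.sum_cons, List.sum_nil, hR]
  have ht := sum_comp_traceCharSum_of_even (F := F) hp hm0 hm hF rfl
  have h0 := traceCharSum_zero_of_even (F := F) hp hm0 hm hF
  generalize (p : ℤ) ^ ((m - 2) / 2) * (-1) ^ (m * (p - 1) / 4) = e at *
  have hin : ∀ t : ZMod p, _ := fun t =>
    sum_comp_quadraticChar_nonzeroInd (F := F) hp hm0 hF (fun η τ =>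
      (p : ℚ) ^ (m - 1) * φ ((p : ℤ) ^ (m - 1) * (p - 1) - η * traceCharSum p F t + τ) +
          ((p : ℚ) ^ m - (p : ℚ) ^ (m - 1)) *
            φ ((p : ℤ) ^ (m - 1) * (p - 1) - η * traceCharSum p F t + τ + 1))
  rw [Finset.sum_congr rfl fun t _ => hin t]
  generalize (p : ℤ) ^ (m - 1) * ((p : ℤ) - 1) = N at *
  generalize traceCharSum p F 0 = s0 at *
  rw [ht (fun s => ((p : ℚ) ^ (m - 1) - 1 + s0) / 2 *
      ((p : ℚ) ^ (m - 1) * φ (N - 1 * s + 0) +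
        ((p : ℚ) ^ m - (p : ℚ) ^ (m - 1)) * φ (N - 1 * s + 0 + 1)) +
    ((p : ℚ) ^ (m - 1) - 1 - s0) / 2 *
      ((p : ℚ) ^ (m - 1) * φ (N - -1 * s + 0) +
        ((p : ℚ) ^ m - (p : ℚ) ^ (m - 1)) * φ (N - -1 * s + 0 + 1)) +
    ((p : ℚ) ^ m - (p : ℚ) ^ (m - 1) - s0) / 2 *
      ((p : ℚ) ^ (m - 1) * φ (N - 1 * s + 1) +
        ((p : ℚ) ^ m - (p : ℚ) ^ (m - 1)) * φ (N - 1 * s + 1 + 1)) +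
    ((p : ℚ) ^ m - (p : ℚ) ^ (m - 1) + s0) / 2 *
      ((p : ℚ) ^ (m - 1) * φ (N - -1 * s + 1) +
        ((p : ℚ) ^ m - (p : ℚ) ^ (m - 1)) * φ (N - -1 * s + 1 + 1)))]
  subst h0
  have hadd : ∀ n : ℤ, n + 1 + 1 = n + 2 := fun n => by ring
  push_cast
  generalize ((p : ℤ) - 1) * e = f at *
  simp only [one_mul, neg_mul, sub_neg_eq_add, ← sub_eq_add_neg, add_zero, neg_neg, hadd, hq]
  generalize (p : ℤ) ^ m = n at *
  ring

omit [Fact p.Prime] [Field F] [Algebra (ZMod p) F] in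
lemma card_coordinates (hF : Fintype.card F = p ^ m) :
    Fintype.card (F ⊕ Fin 2) = p ^ m + 2 := by simp [hF]

lemma three_le_of_odd_prime (hp : Odd p) : 3 ≤ p := by
  have := (Fact.out : p.Prime).two_le
  obtain ⟨l, rfl⟩ := hp
  omega

/-- Twice the number of nonzero `a` of trace zero and quadratic character `ε` is
`p ^ (m - 1) - 1 + ε * traceCharSum p F 0`; if this is positive, such an `a` exists. -/
lemma exists_trace_zero_quadraticChar [DecidableEq F] (hp : Odd p) (hm : 0 < m)
    (hF : Fintype.card F = p ^ m) {ε : ℤ} (hε : ε = 1 ∨ ε = -1)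
    (h : 0 < (p : ℤ) ^ (m - 1) - 1 + ε * traceCharSum p F 0) :
    ∃ a : F, a ≠ 0 ∧ Algebra.trace (ZMod p) F a = 0 ∧ quadraticChar F a = ε := by
  by_contra! hno
  have hs := sum_comp_quadraticChar_nonzeroInd (F := F) hp hm hF
    (fun η τ => if η = ε ∧ τ = 0 then 1 else 0)
  rw [Finset.sum_eq_zero] at hs
  · have h' : (0 : ℚ) < (p : ℚ) ^ (m - 1) - 1 + ε * traceCharSum p F 0 := by exact_mod_cast h
    rcases hε with rfl | rfl
    · norm_num at hs h'; linarith
    · norm_num at hs h'; linarith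
  · intro a ha
    rw [if_neg]
    rintro ⟨h1, h2⟩
    refine hno a (Finset.ne_of_mem_erase ha) ?_ h1
    by_contra h3
    simp [nonzeroInd, h3] at h2

lemma exists_traceCharSum_eq_of_odd [DecidableEq F] (hp : Odd p) (hm : Odd m)
    (hF : Fintype.card F = p ^ m) :
    ∃ t : ZMod p, traceCharSum p F t = (p : ℤ) ^ ((m - 1) / 2) := by
  obtain ⟨s, hs⟩ := exists_not_isSquare hp
  have hs0 : s ≠ 0 := by rintro rfl; exact hs (IsSquare.zero)
  have h1 := traceCharSum_sq_of_odd (F := F) hp hm hF (one_ne_zero (α := ZMod p))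
  have hd : ((p : ℤ) ^ ((m - 1) / 2)) ^ 2 = (p : ℤ) ^ (m - 1) := by
    obtain ⟨k, rfl⟩ := hm
    rw [← pow_mul]; congr 1; omega
  rw [← hd, sq_eq_sq_iff_eq_or_eq_neg] at h1
  rcases h1 with h | h
  · exact ⟨1, h⟩
  -- S(1) has the wrong sign here; the nonsquare s flips it.
  · refine ⟨s * 1, ?_⟩
    rw [traceCharSum_mul hs0, quadraticChar_algebraMap_of_odd hp hm hF hs, h]
    ring

lemma abs_traceCharSum_le_of_odd [DecidableEq F] (hp : Odd p) (hm : Odd m)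
    (hF : Fintype.card F = p ^ m) (t : ZMod p) :
    |traceCharSum p F t| ≤ (p : ℤ) ^ ((m - 1) / 2) := by
  have hd : ((p : ℤ) ^ ((m - 1) / 2)) ^ 2 = (p : ℤ) ^ (m - 1) := by
    obtain ⟨k, rfl⟩ := hm
    rw [← pow_mul]; congr 1; omega
  by_cases ht : t = 0
  · rw [ht, traceCharSum_zero_of_odd hp hm hF, abs_zero]
    positivity
  · apply abs_le_of_sq_le_sq _ (by positivity)
    rw [hd, traceCharSum_sq_of_odd hp hm hF ht]

lemma abs_traceCharSum_le_of_even [DecidableEq F] (hp : Odd p) (hm0 : 0 < m) (hm : Even m)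
    (hF : Fintype.card F = p ^ m) (t : ZMod p) :
    |traceCharSum p F t| ≤ ((p : ℤ) - 1) * (p : ℤ) ^ ((m - 2) / 2) := by
  have hp3 : (3 : ℤ) ≤ p := by exact_mod_cast three_le_of_odd_prime hp
  have hk : (0 : ℤ) < (p : ℤ) ^ ((m - 2) / 2) := by positivity
  by_cases ht : t = 0
  · rw [ht, traceCharSum_zero_of_even hp hm0 hm hF, abs_neg, abs_mul, abs_mul, abs_neg_one_pow,
      mul_one, abs_of_nonneg (by omega), abs_of_pos hk]
  · rw [traceCharSum_of_even hp hm0 hm hF ht, abs_mul, abs_neg_one_pow, mul_one, abs_of_pos hk]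
    nlinarith

/-- A lower bound for the weights in terms of a bound for the character sums. -/
lemma le_hammingNorm_codeword [DecidableEq F] (hp : Odd p) (hm : 0 < m)
    (hF : Fintype.card F = p ^ m) {B d : ℤ}
    (hB : ∀ t : ZMod p, |traceCharSum p F t| ≤ B)
    {d' : ℤ} (hd : d = (p : ℤ) ^ (m - 1) * (p - 1) - B + d') (hd1 : d' ≤ B)
    (htr : ∀ a : F, a ≠ 0 → d' ≤ nonzeroInd (Algebra.trace (ZMod p) F a))
    (a b : F) (c : ZMod p) (h : ¬ (a = 0 ∧ b = 0 ∧ c = 0)) :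
    d ≤ hammingNorm (codeword p F a b c) := by
  have h1 := nonzeroInd_nonneg (Algebra.trace (ZMod p) F a)
  have h2 := nonzeroInd_nonneg (Algebra.trace (ZMod p) F b)
  by_cases ha : a = 0
  · subst ha
    by_cases hb : b = 0
    · subst hb
      have hc : c ≠ 0 := fun hc => h ⟨rfl, rfl, hc⟩
      rw [hammingNorm_codeword_const hF, if_neg hc]
      have hq : (p : ℤ) ^ m = p * (p : ℤ) ^ (m - 1) := by
        rw [← pow_succ', Nat.sub_add_cancel hm]
      have : (0 : ℤ) ≤ (p : ℤ) ^ (m - 1) := by positivity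
      rw [hq, hd]
      linarith
    · rw [hammingNorm_codeword_linear hm hF hb]
      omega
  · rw [hammingNorm_codeword_quadratic hp hm hF ha]
    have h3 := quadraticChar_mul_le_abs ha
      (traceCharSum p F (Algebra.trace (ZMod p) F (b ^ 2 / (4 * a)) - c))
    have h4 := hB (Algebra.trace (ZMod p) F (b ^ 2 / (4 * a)) - c)
    have h5 := htr a ha
    omega

lemma isLinearCode_of_odd (hp : Odd p) (hm : Odd m) (hm1 : 1 < m)
    (hF : Fintype.card F = p ^ m) :
    IsLinearCode (code p F) (p ^ m + 2) (2 * m + 1)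
      (p ^ (m - 1) * (p - 1) - p ^ ((m - 1) / 2)) := by
  classical
  have hp3 := three_le_of_odd_prime hp
  obtain ⟨t, ht⟩ := exists_traceCharSum_eq_of_odd (F := F) hp hm hF
  have hlt := abs_traceCharSum_lt (F := F) hp hm.pos hF t
  rw [ht, abs_of_nonneg (by positivity)] at hlt
  have hcast : ((p ^ (m - 1) * (p - 1) : ℕ) : ℤ) = (p : ℤ) ^ (m - 1) * (p - 1) := by
    push_cast [Nat.cast_sub (show 1 ≤ p by omega)]; rfl
  have hltN : p ^ ((m - 1) / 2) < p ^ (m - 1) * (p - 1) := by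
    zify; rw [← hcast] at hlt; exact_mod_cast hlt
  have hd : ((p ^ (m - 1) * (p - 1) - p ^ ((m - 1) / 2) : ℕ) : ℤ) =
      (p : ℤ) ^ (m - 1) * (p - 1) - (p : ℤ) ^ ((m - 1) / 2) := by
    rw [Nat.cast_sub hltN.le, hcast]; push_cast; rfl
  refine ⟨card_coordinates hF, finrank_code hp hm.pos hF, hasMinDist_code (by omega) ?_ ?_⟩
  · obtain ⟨a, ha, hatr, haq⟩ := exists_trace_zero_quadraticChar (F := F) hp hm.pos hF
      (Or.inl rfl) (by
        rw [traceCharSum_zero_of_odd hp hm hF]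
        have : (1 : ℤ) < (p : ℤ) ^ (m - 1) := one_lt_pow₀ (by omega) (by omega)
        omega)
    -- With b = 0 and c = -t the argument of S is t. As η(a) = 1 and both traces vanish, the weight
    -- is exactly N - S(t). The existence of a uses p^(m-1) > 1, hence m > 1.
    refine ⟨a, 0, -t, ?_⟩
    zify
    rw [hd, hammingNorm_codeword_quadratic hp hm.pos hF ha, haq, hatr]
    simp [ht, nonzeroInd]
  · intro a b c h
    zify
    rw [hd]
    exact le_hammingNorm_codeword hp hm.pos hF
      (abs_traceCharSum_le_of_odd hp hm hF) (add_zero _).symm (by positivity)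
      (fun a _ => nonzeroInd_nonneg _) a b c h

lemma isLinearCode_of_even (hp : Odd p) (hm0 : 0 < m) (hm : Even m)
    (hF : Fintype.card F = p ^ m) :
    IsLinearCode (code p F) (p ^ m + 2) (2 * m + 1)
      (p ^ (m - 1) * (p - 1) - (p - 1) * p ^ ((m - 2) / 2)) := by
  classical
  have hp3 := three_le_of_odd_prime hp
  have hp3' : (3 : ℤ) ≤ p := by exact_mod_cast hp3
  have hlt := abs_traceCharSum_lt (F := F) hp hm0 hF 0
  have hk : (0 : ℤ) < (p : ℤ) ^ ((m - 2) / 2) := by positivity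
  have hE := traceCharSum_zero_of_even (F := F) hp hm0 hm hF
  -- ε is the sign of S(0), where |S| is largest; an a of trace zero with η(a) = ε attains the
  -- weight N - |S(0)|.
  obtain ⟨ε, hε, hεS⟩ : ∃ ε : ℤ, (ε = 1 ∨ ε = -1) ∧
      ε * traceCharSum p F 0 = ((p : ℤ) - 1) * (p : ℤ) ^ ((m - 2) / 2) := by
    rcases neg_one_pow_eq_or ℤ (m * (p - 1) / 4) with h | h
    · exact ⟨-1, Or.inr rfl, by rw [hE, h]; ring⟩
    · exact ⟨1, Or.inl rfl, by rw [hE, h]; ring⟩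
  rw [hE, abs_neg, abs_mul, abs_mul, abs_neg_one_pow, mul_one, abs_of_nonneg (by omega),
    abs_of_pos hk] at hlt
  have hcast : ((p ^ (m - 1) * (p - 1) : ℕ) : ℤ) = (p : ℤ) ^ (m - 1) * (p - 1) := by
    push_cast [Nat.cast_sub (show 1 ≤ p by omega)]; rfl
  have hcast' : (((p - 1) * p ^ ((m - 2) / 2) : ℕ) : ℤ) =
      ((p : ℤ) - 1) * (p : ℤ) ^ ((m - 2) / 2) := by
    push_cast [Nat.cast_sub (show 1 ≤ p by omega)]; rfl
  have hltN : (p - 1) * p ^ ((m - 2) / 2) < p ^ (m - 1) * (p - 1) := by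
    rw [← hcast, ← hcast'] at hlt; exact_mod_cast hlt
  have hd : ((p ^ (m - 1) * (p - 1) - (p - 1) * p ^ ((m - 2) / 2) : ℕ) : ℤ) =
      (p : ℤ) ^ (m - 1) * (p - 1) - ((p : ℤ) - 1) * (p : ℤ) ^ ((m - 2) / 2) := by
    rw [Nat.cast_sub hltN.le, hcast, hcast']
  have hBpos : 0 < ((p : ℤ) - 1) * (p : ℤ) ^ ((m - 2) / 2) := mul_pos (by omega) hk
  refine ⟨card_coordinates hF, finrank_code hp hm0 hF, hasMinDist_code (by omega) ?_ ?_⟩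
  · obtain ⟨a, ha, hatr, haq⟩ := exists_trace_zero_quadraticChar (F := F) hp hm0 hF hε (by
      rw [hεS]
      have : (1 : ℤ) ≤ (p : ℤ) ^ (m - 1) := one_le_pow₀ (by omega)
      omega)
    refine ⟨a, 0, 0, ?_⟩
    zify
    rw [hd, hammingNorm_codeword_quadratic hp hm0 hF ha, haq, hatr]
    simp [hεS, nonzeroInd]
  · intro a b c h
    zify
    rw [hd]
    exact le_hammingNorm_codeword hp hm0 hF
      (abs_traceCharSum_le_of_even hp hm0 hm hF) (add_zero _).symm hBpos.le
      (fun a _ => nonzeroInd_nonneg _) a b c h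

/-- For m = 1 the trace is bijective, so a ≠ 0 forces Tr(a) ≠ 0. With |S| ≤ 1 the least weight is (p
- 1) - 1 + 1, whence `B = 1` and `d' = 1` below. -/
lemma isLinearCode_of_prime (hp : Odd p) (hF : Fintype.card F = p) :
    IsLinearCode (code p F) (p + 2) 3 (p - 1) := by
  classical
  have hp3 := three_le_of_odd_prime hp
  have hF1 : Fintype.card F = p ^ 1 := by rw [hF, pow_one]
  have hinj : Function.Injective (Algebra.trace (ZMod p) F) :=
    ((Fintype.bijective_iff_surjective_and_card _).mpr
      ⟨Algebra.trace_surjective (ZMod p) F, by rw [hF, ZMod.card]⟩).injective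
  have htr : ∀ a : F, a ≠ 0 → Algebra.trace (ZMod p) F a ≠ 0 := fun a ha h =>
    ha (hinj (by rw [h, map_zero]))
  obtain ⟨t, ht⟩ := exists_traceCharSum_eq_of_odd (F := F) hp odd_one hF1
  refine ⟨by simpa using card_coordinates hF1, finrank_code hp one_pos hF1,
    hasMinDist_code (by omega) ⟨1, 0, -t, ?_⟩ ?_⟩
  · zify [show 1 ≤ p by omega]
    rw [hammingNorm_codeword_quadratic hp one_pos hF1 one_ne_zero]
    simp [ht, nonzeroInd, htr 1 one_ne_zero]
  · intro a b c h
    zify [show 1 ≤ p by omega]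
    exact le_hammingNorm_codeword (B := 1) (d' := 1) hp one_pos hF1
      (by simpa using abs_traceCharSum_le_of_odd (F := F) hp odd_one hF1) (by simp) le_rfl
      (fun a ha => by simp [nonzeroInd, htr a ha]) a b c h

end Main

end PAryCode

end

theorem theorem6 (p m : ℕ) [Fact p.Prime] (hp : Odd p) (hm : 0 < m)
    (F : Type*) [Field F] [Fintype F] [Algebra (ZMod p) F] (hF : Fintype.card F = p ^ m) :
    (m = 1 →
      PAryCode.IsLinearCode (PAryCode.code p F) (p + 2) 3 (p - 1) ∧
      PAryCode.IsAlmostMDS (PAryCode.code p F)) ∧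
    (Odd m → 1 < m →
      PAryCode.IsLinearCode (PAryCode.code p F) (p ^ m + 2) (2 * m + 1)
        (p ^ (m - 1) * (p - 1) - p ^ ((m - 1) / 2))) ∧
    (Odd m →
      PAryCode.HasWeightDistribution (PAryCode.code p F) (PAryCode.tableOdd p m)) ∧
    (Even m →
      PAryCode.IsLinearCode (PAryCode.code p F) (p ^ m + 2) (2 * m + 1)
        (p ^ (m - 1) * (p - 1) - (p - 1) * p ^ ((m - 2) / 2)) ∧
      PAryCode.HasWeightDistribution (PAryCode.code p F) (PAryCode.tableEven p m)) := by
  refine ⟨?_, fun ho h1 => PAryCode.isLinearCode_of_odd hp ho h1 hF,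
    fun ho => PAryCode.hasWeightDistribution_of_odd hp ho hF,
    fun he => ⟨PAryCode.isLinearCode_of_even hp hm he hF,
      PAryCode.hasWeightDistribution_of_even hp hm he hF⟩⟩
  rintro rfl
  have h := PAryCode.isLinearCode_of_prime hp (by rw [hF, pow_one] : Fintype.card F = p)
  refine ⟨h, _, _, _, h, ?_⟩
  have := PAryCode.three_le_of_odd_prime hp
  omega
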